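/- Let $D$ be an (unoriented) link diagram in the plane, with finite set of crossings $\mathcal X(D)$. For a subset $S\subset\mathcal X(D)$ (a state), let $D_S$ be the closed $1$-manifold obtained from $D$ by replacing every crossing $c$ with two disjoint arcs: the $0$-smoothing if $c\notin S$ (the one that opens into each other the two regions swept out by turning the over-strand counterclockwise towards the under-strand) and the $1$-smoothing (the other one) if $c\in S$. Let $\pi_0(D_S)$ be the set of circles of $D_S$. For $c\in\mathcal X(D)\setminus S$, if $c$ is adjacent to a single circle $C$ of $D_S$, then $c$ splits $C$ into two circles of $D_{S\cup\{c\}}$; if $c$ is adjacent to two circles of $D_S$, then $c$ merges them into one circle of $D_{S\cup\{c\}}$; the circles of $D_S$ not adjacent to $c$ are identified with the same circles in $D_{S\cup\{c\}}$. A twisting weight on $D$ is a map $$\nu:\coprod_{S\subset\mathcal X(D)}\pi_0(D_S)\to\mathbb Z$$ such that, for all $S\subset\mathcal X(D)$ and $c\in\mathcal X(D)\setminus S$: (a) if $c$ splits $C\in\pi_0(D_S)$ into $C_1',C_2'\in\pi_0(D_{S\cup\{c\}})$, then $\nu(C)=\nu(C_1')+\nu(C_2')-1$; (b) if $c$ merges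 $C_1,C_2\in\pi_0(D_S)$ into $C'\in\pi_0(D_{S\cup\{c\}})$, then $\nu(C_1)+\nu(C_2)=\nu(C')$; (c) if $C\in\pi_0(D_S)$ is not adjacent to $c$ and is identified with $C'\in\pi_0(D_{S\cup\{c\}})$, then $\nu(C)=\nu(C')$. Proposition. If $D_\varnothing$ is connected, i.e. consists of exactly one circle, then $D$ admits a twisting weight. -/

import Mathlib

universe u

/-- The planar diagram code of a `4`-valent map with over/under information, not yet required to
be planar.  The four half-edges at a crossing `c` are `(c, 0), (c, 1), (c, 2), (c, 3)` in
counterclockwise order, where `(c, 0)` and `(c, 2)` lie on the under-strand and `(c, 1)` and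
`(c, 3)` lie on the over-strand.  The involution `opp` sends a half-edge to the other half of the
same edge.  `Loop` is the set of components that run through no crossing at all. -/
structure PDCode where
  Crossing : Type u
  Loop : Type u
  [finite_crossing : Finite Crossing]
  [finite_loop : Finite Loop]
  opp : Equiv.Perm (Crossing × ZMod 4)
  opp_opp : ∀ h, opp (opp h) = h
  opp_ne : ∀ h, opp h ≠ h

namespace PDCode

attribute [instance] PDCode.finite_crossing PDCode.finite_loop

variable (D : PDCode.{u})

/-- Half-edges at the crossings. -/
abbrev HalfEdge : Type u := D.Crossing × ZMod 4

/-- The counterclockwise rotation by one step around each crossing. -/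
def rot : Equiv.Perm D.HalfEdge := (Equiv.refl D.Crossing).prodCongr (Equiv.addRight 1)

/-- Edges of the underlying `4`-valent graph (crossingless loops not counted). -/
def Edge : Type u := Quotient (Equiv.Perm.SameCycle.setoid D.opp)

/-- Faces of the underlying map: the cycles of "cross the edge, then turn to the next half-edge
around the crossing reached". -/
def Face : Type u := Quotient (Equiv.Perm.SameCycle.setoid (D.opp.trans D.rot))

/-- Two half-edges that belong to the same edge or to the same crossing. -/
def Incident (h k : D.HalfEdge) : Prop := k = D.opp h ∨ k.1 = h.1

/-- Connected components of the underlying `4`-valent graph (crossingless loops not counted). -/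
def GraphComponent : Type u := Quot D.Incident

/-- Planarity.  A component of genus `g` contributes `2 - 2 * g` to `V - E + F`, so the equality
says that every component of the underlying map lies on a sphere, i.e. can be drawn in the plane
with the given cyclic orders at the crossings. -/
def IsPlanar : Prop :=
  (Nat.card D.Crossing : ℤ) - Nat.card D.Edge + Nat.card D.Face = 2 * Nat.card D.GraphComponent

end PDCode

/-- An (unoriented) link diagram in the plane, given by its planar diagram code together with its
crossingless components. -/
structure LinkDiagram extends PDCode.{u} where
  planar : toPDCode.IsPlanar

namespace LinkDiagram

variable (D : LinkDiagram.{u})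

/-- A state on a diagram is a set of crossings. -/
abbrev State : Type u := Set D.Crossing

/-- The pieces of the diagram from which all smoothings are assembled: the half-edges and the
crossingless loops. -/
abbrev Piece : Type u := D.HalfEdge ⊕ D.Loop

/-- Adjacency of pieces in the smoothing `D_S`.  The two halves of an edge are joined.  A crossing
outside `S` is replaced by two arcs joining its half-edges `0, 1` and `2, 3` (the two regions swept
out by turning the over-strand counterclockwise are opened into each other); a crossing in
`S` is replaced by two arcs joining its half-edges `0, 3` and `1, 2`. -/
inductive Joined (S : D.State) : D.Piece → D.Piece → Prop
  | edge (h : D.HalfEdge) : Joined S (Sum.inl h) (Sum.inl (D.opp h))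
  | zero_smoothing (c : D.Crossing) (hc : c ∉ S) (i : ZMod 4) :
      Joined S (Sum.inl (c, i)) (Sum.inl (c, 1 - i))
  | one_smoothing (c : D.Crossing) (hc : c ∈ S) (i : ZMod 4) :
      Joined S (Sum.inl (c, i)) (Sum.inl (c, 3 - i))

/-- The set `π₀(D_S)` of circles of the smoothing `D_S`. -/
def Circle (S : D.State) : Type u := Quot (D.Joined S)

variable {D}

/-- The pieces of which a circle of `D_S` consists. -/
def Circle.pieces {S : D.State} (C : D.Circle S) : Set D.Piece := {p | Quot.mk (D.Joined S) p = C}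

/-- The crossing `c` is adjacent to the circle `C` of `D_S`. -/
def Adjacent {S : D.State} (c : D.Crossing) (C : D.Circle S) : Prop :=
  ∃ i : ZMod 4, Sum.inl (c, i) ∈ C.pieces

/-- `c` is adjacent to the single circle `C` of `D_S`, and splits it into the two circles
`C₁ ≠ C₂` of `D_{S ∪ {c}}`. -/
def Splits {S : D.State} (c : D.Crossing) (C : D.Circle S) (C₁ C₂ : D.Circle (insert c S)) :
    Prop :=
  (∀ B : D.Circle S, Adjacent c B ↔ B = C) ∧
    C₁ ≠ C₂ ∧ ∀ B : D.Circle (insert c S), Adjacent c B ↔ B = C₁ ∨ B = C₂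

/-- `c` is adjacent to the two circles `C₁ ≠ C₂` of `D_S`, and merges them into the single circle
`C` of `D_{S ∪ {c}}`. -/
def Merges {S : D.State} (c : D.Crossing) (C₁ C₂ : D.Circle S) (C : D.Circle (insert c S)) :
    Prop :=
  C₁ ≠ C₂ ∧ (∀ B : D.Circle S, Adjacent c B ↔ B = C₁ ∨ B = C₂) ∧
    ∀ B : D.Circle (insert c S), Adjacent c B ↔ B = C

/-- `C` is a circle of `D_S` apart from `c`, and `C'` is the same circle in `D_{S ∪ {c}}`. -/
def Identified {S : D.State} (c : D.Crossing) (C : D.Circle S) (C' : D.Circle (insert c S)) :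
    Prop :=
  ¬ Adjacent c C ∧ C.pieces = C'.pieces

variable (D)

/-- Twisting weights: integer labels of all circles of all smoothings of `D`. -/
structure IsTwistingWeight (ν : (Σ S : D.State, D.Circle S) → ℤ) : Prop where
  split : ∀ (S : D.State) (c : D.Crossing), c ∉ S →
    ∀ (C : D.Circle S) (C₁ C₂ : D.Circle (insert c S)), Splits c C C₁ C₂ →
      ν ⟨S, C⟩ = ν ⟨insert c S, C₁⟩ + ν ⟨insert c S, C₂⟩ - 1
  merge : ∀ (S : D.State) (c : D.Crossing), c ∉ S →
    ∀ (C₁ C₂ : D.Circle S) (C : D.Circle (insert c S)), Merges c C₁ C₂ C →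
      ν ⟨S, C₁⟩ + ν ⟨S, C₂⟩ = ν ⟨insert c S, C⟩
  identify : ∀ (S : D.State) (c : D.Crossing), c ∉ S →
    ∀ (C : D.Circle S) (C' : D.Circle (insert c S)), Identified c C C' →
      ν ⟨S, C⟩ = ν ⟨insert c S, C'⟩

/-- The smoothing `D_S` is connected: it consists of exactly one circle. -/
def SmoothingConnected (S : D.State) : Prop := Nat.card (D.Circle S) = 1

end LinkDiagram

/-! Since `D_∅` is one circle, the crossings become chords attached to it, of two kinds (inside and
outside), and planarity forbids crossings between chords of one kind. Fix a direction and a base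
point on the circle. Each chord cuts it into two arcs; mark the end of the chord at which the arc
without the base point starts. For a circle `C` of `D_S` let `W(C)` count the marked ends on `C` of
chords in `S`, plus one if the base point is on `C`. The weight is `ν(C) = (1 + W(C)) / 2`. Adding
`c` to `S` adds one marked end to the union of the circles at `c` and changes nothing elsewhere,
which gives (a), (b) and (c) as soon as `W` is odd.

Oddness is `ChordDiagram.total_eq_one`, by induction on `S`: a chord with both or no ends on `C` can
be removed. What remains is the case that all chords of `S` join the same two circles; by
`subsingleton_of_join` there is then only one chord.

Planarity enters through Euler's formula. The face permutation arises from the directed walk along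
`D_∅` by one transposition per crossing. The walk has at most two cycles and there are at least `V +
2` faces, so each of the `V` transpositions splits a cycle, in any order (`sameCycle_cross`). A
single one shows that `1`-smoothings respect the direction of `D_∅`; two in succession show that
chords of one kind do not cross. -/

open Equiv Equiv.Perm

/-! ### Cycles of a permutation times a transposition -/

namespace Equiv.Perm

variable {α : Type*}

theorem SameCycle.apply_eq_of_invariant {β : Type*} {φ : Perm α} {f : α → β}
    (hf : ∀ p, f (φ p) = f p) {p q : α} (h : φ.SameCycle p q) : f p = f q := by
  obtain ⟨n, rfl⟩ := h
  induction n with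
  | zero => simp
  | succ n ih => rw [add_comm, zpow_add, mul_apply, zpow_one, hf, ih]
  | pred n ih =>
    rw [ih, ← hf ((φ ^ (-(n : ℤ) - 1)) p), ← mul_apply, ← zpow_one_add]
    congr 3
    ring

theorem sameCycle_invariant (φ : Perm α) (p q : α) : φ.SameCycle p (φ q) = φ.SameCycle p q :=
  propext sameCycle_apply_right

/-- The number of cycles of a permutation, fixed points included. -/
noncomputable def numCycles (φ : Perm α) : ℕ := Nat.card (Quotient (SameCycle.setoid φ))

/-- The map from cycles of `φ` to values of an invariant function. -/
def cycleLift {β : Type*} {φ : Perm α} (f : α → β) (hf : ∀ p, f (φ p) = f p) :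
    Quotient (SameCycle.setoid φ) → β :=
  Quotient.lift f fun _ _ h => SameCycle.apply_eq_of_invariant hf h

theorem mk_apply_eq (φ : Perm α) (p : α) :
    (Quotient.mk (SameCycle.setoid φ) (φ p)) = Quotient.mk (SameCycle.setoid φ) p :=
  Quotient.sound (sameCycle_apply_left.2 (SameCycle.refl _ _))

variable [DecidableEq α] {φ : Perm α} {x y : α}

theorem swap_mul_invariant {β : Type*} {f : α → β} (hf : ∀ p, f (φ p) = f p) (hxy : f x = f y)
    (p : α) : f ((swap x y * φ) p) = f p := by
  rw [mul_apply, ← hf p]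
  rcases eq_or_ne (φ p) x with h | hx
  · rw [h, swap_apply_left, hxy]
  rcases eq_or_ne (φ p) y with h | hy
  · rw [h, swap_apply_right, hxy]
  rw [swap_apply_of_ne_of_ne hx hy]

theorem SameCycle.of_swap_mul {p q : α} (hxy : φ.SameCycle p x ↔ φ.SameCycle p y)
    (h : (swap x y * φ).SameCycle p q) : φ.SameCycle p q := by
  have := h.apply_eq_of_invariant
    (swap_mul_invariant (f := φ.SameCycle p) (sameCycle_invariant φ p) (propext hxy))
  rw [← this]

theorem sameCycle_swap_mul_iff_of_not {p q : α} (hx : ¬ φ.SameCycle p x)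
    (hy : ¬ φ.SameCycle p y) : (swap x y * φ).SameCycle p q ↔ φ.SameCycle p q := by
  have key : ∀ q, (swap x y * φ).SameCycle p q → φ.SameCycle p q :=
    fun q => SameCycle.of_swap_mul (iff_of_false hx hy)
  refine ⟨key q, fun h => ?_⟩
  have := SameCycle.of_swap_mul (φ := swap x y * φ) (x := x) (y := y) (p := p) (q := q)
    (iff_of_false (fun h => hx (key _ h)) (fun h => hy (key _ h)))
  rw [swap_mul_self_mul] at this
  exact this h

/-- Otherwise the whole `φ`-cycle of `x` would stay in the new cycle of `x`; but the predecessor of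
`x` is now sent to `y`. -/
theorem sameCycle_swap_mul_of_not [Finite α] (h : ¬ φ.SameCycle x y) :
    (swap x y * φ).SameCycle x y := by
  by_contra h'
  set ψ := swap x y * φ with hψ
  have hfin : ∀ q, φ.SameCycle x q → ψ.SameCycle x q := by
    intro q hq
    obtain ⟨n, -, rfl⟩ := hq.exists_pow_eq'
    clear hq
    induction n with
    | zero => exact SameCycle.refl _ _
    | succ n ih =>
      have hmem : φ.SameCycle x ((φ ^ n) x) := ⟨n, by simp⟩
      rw [pow_succ', mul_apply]
      set q := (φ ^ n) x
      have h1 : ψ.SameCycle x (ψ q) := sameCycle_apply_right.2 ih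
      rcases eq_or_ne (φ q) x with hx | hx
      · rw [hx]
      rcases eq_or_ne (φ q) y with hy | hy
      · exact absurd (hy ▸ sameCycle_apply_right.2 hmem) h
      rwa [hψ, mul_apply, swap_apply_of_ne_of_ne hx hy] at h1
  have h1 : ψ.SameCycle x (φ.symm x) := hfin _ (by
    rw [← sameCycle_apply_right, apply_symm_apply])
  have h2 := sameCycle_apply_right.2 h1
  rw [hψ, mul_apply, apply_symm_apply, swap_apply_left] at h2
  exact h' h2

/-- From `x` the new permutation follows `φ` until just before the first visit to `y`, then returns
to `x`. -/
theorem not_sameCycle_swap_mul [Finite α] (hne : x ≠ y) (h : φ.SameCycle x y) :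
    ¬ (swap x y * φ).SameCycle x y := by
  intro h'
  have hex : ∃ n : ℕ, (φ ^ n) x = y := by
    obtain ⟨n, -, hn⟩ := h.exists_pow_eq'
    exact ⟨n, hn⟩
  classical
  let k := Nat.find hex
  have hk : (φ ^ k) x = y := Nat.find_spec hex
  have hmin : ∀ m < k, (φ ^ m) x ≠ y := fun m hm => Nat.find_min hex hm
  have hk0 : 0 < k := by
    rcases Nat.eq_zero_or_pos k with h0 | h0
    · rw [h0] at hk
      exact absurd hk hne
    · exact h0
  have hstep : ∀ n : ℕ, ∃ i < k, ((swap x y * φ) ^ n) x = (φ ^ i) x := by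
    intro n
    induction n with
    | zero => exact ⟨0, hk0, rfl⟩
    | succ n ih =>
      obtain ⟨i, hi, hn⟩ := ih
      rw [pow_succ', mul_apply, hn, mul_apply, ← mul_apply φ, ← pow_succ']
      rcases eq_or_lt_of_le (Nat.succ_le_of_lt hi) with hik | hik
      · refine ⟨0, hk0, ?_⟩
        rw [show i + 1 = k from hik, hk, swap_apply_right]
        rfl
      · refine ⟨i + 1, hik, swap_apply_of_ne_of_ne (fun hx => ?_) (hmin _ hik)⟩
        refine hmin (k - (i + 1)) (by omega) ?_
        rw [← hk]
        conv_lhs => rw [← hx]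
        rw [← mul_apply, ← pow_add, Nat.sub_add_cancel hik.le]
  obtain ⟨n, -, hn⟩ := h'.exists_pow_eq'
  obtain ⟨i, hi, hi'⟩ := hstep n
  exact hmin i hi (hi'.symm.trans hn)

theorem sameCycle_iff_swap_mul_or {q : α} (h : φ.SameCycle x y) :
    φ.SameCycle x q ↔ (swap x y * φ).SameCycle x q ∨ (swap x y * φ).SameCycle y q := by
  constructor
  · intro hq
    by_contra! hn
    have := sameCycle_swap_mul_iff_of_not (φ := swap x y * φ) (x := x) (y := y) (p := q) (q := x)
      (fun h => hn.1 h.symm) (fun h => hn.2 h.symm)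
    rw [swap_mul_self_mul] at this
    exact hn.1 (this.1 hq.symm).symm
  · rintro (hq | hq)
    · exact hq.of_swap_mul (iff_of_true (SameCycle.refl _ _) h)
    · exact h.trans (hq.of_swap_mul (iff_of_true h.symm (SameCycle.refl _ _)))

/-- Identifying the new cycles of `x` and `y` gives a `φ`-invariant function, so the cycles of `φ`
account for every new cycle except possibly that of `y`. -/
theorem numCycles_swap_mul_le_succ [Finite α] :
    numCycles (swap x y * φ) ≤ numCycles φ + 1 := by
  classical
  set ψ := swap x y * φ with hψ
  let mk : α → Quotient (SameCycle.setoid ψ) := Quotient.mk _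
  let f : α → Quotient (SameCycle.setoid ψ) := fun p => if mk p = mk y then mk x else mk p
  have hfψ : ∀ p, f (ψ p) = f p := fun p => by
    simp only [f, mk, mk_apply_eq]
  have hfxy : f x = f y := by simp [f]
  have hf : ∀ p, f (φ p) = f p := by
    have := swap_mul_invariant hfψ hfxy
    rwa [show swap x y * ψ = φ from swap_mul_self_mul x y φ] at this
  let g : Option (Quotient (SameCycle.setoid φ)) → Quotient (SameCycle.setoid ψ) :=
    fun o => o.elim (mk y) (cycleLift f hf)
  have hg : Function.Surjective g := by
    intro b
    obtain ⟨p, rfl⟩ := Quotient.exists_rep b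
    by_cases hp : mk p = mk y
    · exact ⟨none, hp.symm⟩
    · refine ⟨some (Quotient.mk _ p), ?_⟩
      change f p = mk p
      simp [f, hp]
  have := Nat.card_le_card_of_surjective g hg
  rwa [Finite.card_option] at this

theorem numCycles_swap_mul_le [Finite α] (h : ¬ φ.SameCycle x y) :
    numCycles (swap x y * φ) ≤ numCycles φ := by
  set ψ := swap x y * φ with hψ
  let mk : α → Quotient (SameCycle.setoid ψ) := Quotient.mk _
  have hxy : mk x = mk y := Quotient.sound (sameCycle_swap_mul_of_not h)
  have hf : ∀ p, mk (φ p) = mk p := by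
    have := swap_mul_invariant (φ := ψ) (f := mk) (mk_apply_eq ψ) hxy
    rwa [show swap x y * ψ = φ from swap_mul_self_mul x y φ] at this
  refine Nat.card_le_card_of_surjective (cycleLift mk hf) fun b => ?_
  obtain ⟨p, rfl⟩ := Quotient.exists_rep b
  exact ⟨Quotient.mk _ p, rfl⟩

end Equiv.Perm

/-! ### Parity of the weights in a chord diagram -/

/-- Disjoint chords on an oriented circle, of two kinds, such that chords of one kind do not cross.
`side c` tells apart the two arcs into which the ends of `c` divide the circle. -/
structure ChordDiagram (κ α : Type*) where
  chord : α → κ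
  chord_surjective : Function.Surjective chord
  mate : α → α
  chord_mate : ∀ p, chord (mate p) = chord p
  mate_ne : ∀ p, mate p ≠ p
  eq_or_eq_mate : ∀ p q, chord p = chord q → q = p ∨ q = mate p
  step : Set κ → Perm α
  step_of_mem : ∀ S p, chord (step ∅ p) ∈ S → step S p = mate (step ∅ p)
  step_of_notMem : ∀ S p, chord (step ∅ p) ∉ S → step S p = step ∅ p
  connected : ∀ p q, (step ∅).SameCycle p q
  side : κ → α → ZMod 2
  side_step_chord : ∀ p, side (chord (step ∅ p)) (step ∅ p) = side (chord (step ∅ p)) p + 1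
  side_step : ∀ c p, chord (step ∅ p) ≠ c → side c (step ∅ p) = side c p
  side_mate_chord : ∀ p, side (chord p) (mate p) = side (chord p) p + 1
  inner : Set κ
  side_mate : ∀ c p, chord p ≠ c → (chord p ∈ inner ↔ c ∈ inner) → side c (mate p) = side c p
  base : α
  side_base : ∀ c, side c base = 0

namespace ChordDiagram

variable {κ α : Type*} (X : ChordDiagram κ α)

theorem mate_mate (p : α) : X.mate (X.mate p) = p := by
  rcases X.eq_or_eq_mate (X.mate p) p (X.chord_mate p) with h | h
  · exact absurd h.symm (X.mate_ne p)
  · exact h.symm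

/-- Removing a chord is multiplication by the transposition of its ends, so circles split and merge
as cycles do. -/
theorem step_eq_swap_mul [DecidableEq α] {S : Set κ} {x : α} (hx : X.chord x ∈ S) :
    X.step (S \ {X.chord x}) = swap x (X.mate x) * X.step S := by
  ext p
  rw [mul_apply]
  by_cases h : X.chord (X.step ∅ p) ∈ S
  · rw [X.step_of_mem S p h]
    by_cases hc : X.chord (X.step ∅ p) = X.chord x
    · rw [X.step_of_notMem _ _ (by simp [hc])]
      rcases X.eq_or_eq_mate _ _ hc.symm with h' | h'
      · rw [h', swap_apply_right]
      · rw [h', X.mate_mate, swap_apply_left]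
    · rw [X.step_of_mem _ _ (Set.mem_sdiff_of_mem h hc), swap_apply_of_ne_of_ne]
      · intro h'
        exact hc (by rw [← h', X.chord_mate])
      · intro h'
        exact hc (by rw [← X.chord_mate, h', X.chord_mate])
  · rw [X.step_of_notMem S p h, X.step_of_notMem _ p (fun h' => h h'.1), swap_apply_of_ne_of_ne]
    · rintro rfl
      exact h hx
    · intro h'
      exact h (by rwa [h', X.chord_mate])

/-- By `hin`, the change on arriving at an end equals the change across its chord; modulo 2 they
cancel. -/
theorem step_invariant {S : Set κ} {f : α → ZMod 2}
    (hin : ∀ p, X.chord (X.step ∅ p) ∈ S →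
      f (X.step ∅ p) = f p + (f (X.mate (X.step ∅ p)) + f (X.step ∅ p)))
    (hout : ∀ p, X.chord (X.step ∅ p) ∉ S → f (X.step ∅ p) = f p) (p : α) :
    f (X.step S p) = f p := by
  by_cases h : X.chord (X.step ∅ p) ∈ S
  · rw [X.step_of_mem S p h]
    have := hin p h
    grind
  · rw [X.step_of_notMem S p h, hout p h]

open Classical in
/-- The local contribution of a point to twice the weight of its circle. -/
noncomputable def weight (S : Set κ) (p : α) : ZMod 2 :=
  (if p = X.base then 1 else 0) + if X.chord p ∈ S then X.side (X.chord p) p else 0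

theorem weight_diff_of_ne {S : Set κ} {c : κ} {p : α} (h : X.chord p ≠ c) :
    X.weight (S \ {c}) p = X.weight S p := by
  have : X.chord p ∈ S \ {c} ↔ X.chord p ∈ S := ⟨fun h' => h'.1, fun h' => ⟨h', h⟩⟩
  classical
  simp only [weight, this]

theorem weight_of_chord_mem {S : Set κ} {p : α} (h : X.chord p ∈ S) :
    X.weight S p = X.weight (S \ {X.chord p}) p + X.side (X.chord p) p := by
  simp [weight, h]

open Classical in
/-- An integral lift of `weight`. -/
noncomputable def intWeight (S : Set κ) (p : α) : ℤ :=
  (if p = X.base then 1 else 0) + if X.chord p ∈ S then ((X.side (X.chord p) p).val : ℤ) else 0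

theorem intCast_intWeight (S : Set κ) (p : α) : (X.intWeight S p : ZMod 2) = X.weight S p := by
  simp [intWeight, weight]

theorem intWeight_insert_of_ne {S : Set κ} {c : κ} {p : α} (h : X.chord p ≠ c) :
    X.intWeight (insert c S) p = X.intWeight S p := by
  have : X.chord p ∈ insert c S ↔ X.chord p ∈ S := Set.mem_insert_iff.trans (or_iff_right h)
  classical
  simp only [intWeight, this]

theorem intWeight_insert {S : Set κ} {p : α} (h : X.chord p ∉ S) :
    X.intWeight (insert (X.chord p) S) p = X.intWeight S p + (X.side (X.chord p) p).val := by
  simp [intWeight, h]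

open Classical in
/-- The sum of a function over the circle through a point. -/
noncomputable def total [Fintype α] (S T : Set κ) (x : α) : ZMod 2 :=
  ∑ p, if (X.step S).SameCycle x p then X.weight T p else 0

variable [Fintype α]

theorem total_congr {S T S' T' : Set κ} {x y : α}
    (h : ∀ p, (X.step S).SameCycle x p ↔ (X.step S').SameCycle y p)
    (hw : ∀ p, (X.step S).SameCycle x p → X.weight T p = X.weight T' p) :
    X.total S T x = X.total S' T' y := by
  classical
  refine Finset.sum_congr rfl fun p _ => ?_
  by_cases hp : (X.step S).SameCycle x p
  · rw [if_pos hp, if_pos ((h p).1 hp), hw p hp]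
  · rw [if_neg hp, if_neg (fun h' => hp ((h p).2 h'))]

theorem total_union {S S' T : Set κ} {x y z : α}
    (h : ∀ p, (X.step S).SameCycle z p ↔ (X.step S').SameCycle x p ∨ (X.step S').SameCycle y p)
    (hd : ¬ (X.step S').SameCycle x y) : X.total S T z = X.total S' T x + X.total S' T y := by
  classical
  rw [total, total, total, ← Finset.sum_add_distrib]
  refine Finset.sum_congr rfl fun p _ => ?_
  by_cases hx : (X.step S').SameCycle x p
  · have hy : ¬ (X.step S').SameCycle y p := fun hy => hd (hx.trans hy.symm)
    simp [h, hx, hy]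
  · simp [h, hx]

open Classical in
/-- Adding `c` to the weighting set changes the total by the sides of the ends of `c`. -/
theorem total_eq_diff {S : Set κ} (T : Set κ) {x z : α} (hx : X.chord x ∈ S) :
    X.total T S z = X.total T (S \ {X.chord x}) z +
      ((if (X.step T).SameCycle z x then X.side (X.chord x) x else 0) +
      if (X.step T).SameCycle z (X.mate x) then X.side (X.chord x) (X.mate x) else 0) := by
  have key : ∀ p, (if (X.step T).SameCycle z p then X.weight S p else 0) =
      (if (X.step T).SameCycle z p then X.weight (S \ {X.chord x}) p else 0) +
      ((if p = x then if (X.step T).SameCycle z x then X.side (X.chord x) x else 0 else 0) +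
      if p = X.mate x then
        if (X.step T).SameCycle z (X.mate x) then X.side (X.chord x) (X.mate x) else 0 else 0) := by
    intro p
    rcases eq_or_ne p x with rfl | h1
    · rw [if_pos rfl, if_neg (X.mate_ne p).symm, X.weight_of_chord_mem hx]
      split_ifs <;> simp
    rcases eq_or_ne p (X.mate x) with rfl | h2
    · have := X.weight_of_chord_mem (S := S) (p := X.mate x) (by rwa [X.chord_mate])
      rw [X.chord_mate] at this
      rw [if_neg h1, if_pos rfl, this]
      split_ifs <;> simp
    · rw [if_neg h1, if_neg h2, X.weight_diff_of_ne, add_zero, add_zero]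
      intro h
      rcases X.eq_or_eq_mate x p h.symm with h | h
      exacts [h1 h, h2 h]
  rw [total, total, Finset.sum_congr rfl fun p _ => key p, Finset.sum_add_distrib,
    Finset.sum_add_distrib, Finset.sum_ite_eq' , Finset.sum_ite_eq']
  simp

theorem total_empty (z : α) : X.total ∅ ∅ z = 1 := by
  classical
  simp [total, weight, X.connected z]

/-- A chord away from a circle may be ignored. -/
theorem total_of_not_touch {S : Set κ} {x z : α} (hx : X.chord x ∈ S)
    (h1 : ¬ (X.step S).SameCycle z x) (h2 : ¬ (X.step S).SameCycle z (X.mate x)) :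
    X.total S S z = X.total (S \ {X.chord x}) (S \ {X.chord x}) z := by
  classical
  rw [X.total_eq_diff S hx, if_neg h1, if_neg h2, add_zero, add_zero]
  refine X.total_congr (fun p => ?_) fun p _ => rfl
  rw [X.step_eq_swap_mul hx]
  exact (sameCycle_swap_mul_iff_of_not h1 h2).symm

/-- The final `1` is the sum of the opposite sides of the two ends. -/
theorem total_of_touch_twice {S : Set κ} {x : α} (hx : X.chord x ∈ S)
    (h : (X.step S).SameCycle x (X.mate x)) :
    X.total S S x = X.total (S \ {X.chord x}) (S \ {X.chord x}) x +
      X.total (S \ {X.chord x}) (S \ {X.chord x}) (X.mate x) + 1 := by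
  classical
  rw [X.total_eq_diff S hx, if_pos (SameCycle.refl _ _), if_pos h, X.side_mate_chord]
  rw [X.total_union (S' := S \ {X.chord x}) (x := x) (y := X.mate x)]
  · grind
  · intro p
    rw [X.step_eq_swap_mul hx]
    exact sameCycle_iff_swap_mul_or h
  · rw [X.step_eq_swap_mul hx]
    exact not_sameCycle_swap_mul (X.mate_ne x).symm h

theorem step_diff_sameCycle_iff {S : Set κ} {x p : α} (hx : X.chord x ∈ S)
    (h : ¬ (X.step S).SameCycle x (X.mate x)) :
    (X.step (S \ {X.chord x})).SameCycle x p ↔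
      (X.step S).SameCycle x p ∨ (X.step S).SameCycle (X.mate x) p := by
  classical
  have := sameCycle_iff_swap_mul_or (q := p) (sameCycle_swap_mul_of_not h)
  rw [swap_mul_self_mul] at this
  rwa [X.step_eq_swap_mul hx]

theorem total_of_touch_once {S : Set κ} {x : α} (hx : X.chord x ∈ S)
    (h : ¬ (X.step S).SameCycle x (X.mate x)) :
    X.total S S x + X.total S S (X.mate x) =
      X.total (S \ {X.chord x}) (S \ {X.chord x}) x + 1 := by
  classical
  have h' : ¬ (X.step S).SameCycle (X.mate x) x := fun h' => h h'.symm
  rw [X.total_union (fun p => X.step_diff_sameCycle_iff hx h) h, X.total_eq_diff S hx,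
    X.total_eq_diff (z := X.mate x) S hx, if_pos (SameCycle.refl _ _), if_neg h, if_neg h',
    if_pos (SameCycle.refl _ _), X.side_mate_chord]
  grind

open Classical in
/-- If every chord of `S` joins the same two circles, then `S` has at most one chord. -/
theorem subsingleton_of_join [Finite κ] {S : Set κ} {x y : α}
    (h : ∀ p, X.chord p ∈ S → ((X.step S).SameCycle x p ∧ (X.step S).SameCycle y (X.mate p)) ∨
      ((X.step S).SameCycle y p ∧ (X.step S).SameCycle x (X.mate p)))
    (hxy : ¬ (X.step S).SameCycle x y) : S.Subsingleton := by
  have := Fintype.ofFinite κ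
  have hne : ∀ p, X.chord p ∈ S →
      ((X.step S).SameCycle x (X.mate p) ↔ ¬ (X.step S).SameCycle x p) := by
    intro p hp
    rcases h p hp with ⟨h1, h2⟩ | ⟨h1, h2⟩
    · exact iff_of_false (fun h3 => hxy (h3.trans h2.symm)) (fun h3 => h3 h1)
    · exact iff_of_true h2 (fun h3 => hxy (h3.trans h1.symm))
  -- An invariant function that distinguishes the ends of one chord does so for all.
  have inv : ∀ f : α → ZMod 2, (∀ p, f (X.step S p) = f p) → ∀ p q, X.chord p ∈ S →
      X.chord q ∈ S → f (X.mate p) = f p → f (X.mate q) = f q := by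
    intro f hf p q hp hq hfp
    have hfxy : f x = f y := by
      rcases h p hp with ⟨h1, h2⟩ | ⟨h1, h2⟩
      · rw [h1.apply_eq_of_invariant hf, h2.apply_eq_of_invariant hf, hfp]
      · rw [h1.apply_eq_of_invariant hf, h2.apply_eq_of_invariant hf, hfp]
    rcases h q hq with ⟨h1, h2⟩ | ⟨h1, h2⟩
    · rw [← h1.apply_eq_of_invariant hf, ← h2.apply_eq_of_invariant hf, hfxy]
    · rw [← h1.apply_eq_of_invariant hf, ← h2.apply_eq_of_invariant hf, hfxy]
  -- Sums of side functions.
  let f : Set κ → α → ZMod 2 := fun T p => ∑ c, if c ∈ T then X.side c p else 0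
  have f_step_in : ∀ T p, X.chord (X.step ∅ p) ∈ T → f T (X.step ∅ p) = f T p + 1 := by
    intro T p hp
    have : (1 : ZMod 2) = ∑ c, if c = X.chord (X.step ∅ p) then 1 else 0 := by simp
    simp only [f]
    rw [this, ← Finset.sum_add_distrib]
    refine Finset.sum_congr rfl fun c _ => ?_
    by_cases hc : c = X.chord (X.step ∅ p)
    · subst hc
      simp [hp, X.side_step_chord]
    · simp [hc, X.side_step c p (Ne.symm hc)]
  have f_step_out : ∀ T p, X.chord (X.step ∅ p) ∉ T → f T (X.step ∅ p) = f T p := by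
    intro T p hp
    refine Finset.sum_congr rfl fun c _ => ?_
    by_cases hc : c ∈ T
    · rw [if_pos hc, if_pos hc, X.side_step c p]
      rintro rfl
      exact hp hc
    · rw [if_neg hc, if_neg hc]
  have f_mate_in : ∀ T, (∀ c ∈ T, ∀ d ∈ T, (c ∈ X.inner ↔ d ∈ X.inner)) →
      ∀ p, X.chord p ∈ T → f T (X.mate p) = f T p + 1 := by
    intro T hT p hp
    have : (1 : ZMod 2) = ∑ c, if c = X.chord p then 1 else 0 := by simp
    simp only [f]
    rw [this, ← Finset.sum_add_distrib]
    refine Finset.sum_congr rfl fun c _ => ?_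
    by_cases hc : c = X.chord p
    · subst hc
      simp [hp, X.side_mate_chord]
    · by_cases hcT : c ∈ T
      · simp [hc, hcT, X.side_mate c p (Ne.symm hc) (hT _ hp _ hcT)]
      · simp [hc, hcT]
  have f_add : ∀ T p, f S p = f (S ∩ T) p + f (S \ T) p := by
    intro T p
    simp only [f, ← Finset.sum_add_distrib]
    refine Finset.sum_congr rfl fun c _ => ?_
    by_cases h1 : c ∈ S <;> by_cases h2 : c ∈ T <;> simp [h1, h2]
  -- The sum over all of `S` is the indicator of a circle up to a constant.
  have f_all : ∀ p, X.chord p ∈ S → f S (X.mate p) = f S p + 1 := by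
    let g : α → ZMod 2 := fun p => if (X.step S).SameCycle x p then 1 else 0
    have g_mate : ∀ p, X.chord p ∈ S → g (X.mate p) = g p + 1 := by
      intro p hp
      by_cases h1 : (X.step S).SameCycle x p
      · simp only [g, hne p hp, h1]
        decide
      · simp [g, hne p hp, h1]
    have g_step : ∀ p, g (X.step S p) = g p := fun p => by simp [g]
    have hconst : ∀ p, (f S + g) (X.step ∅ p) = (f S + g) p := by
      intro p
      have := g_step p
      simp only [Pi.add_apply]
      by_cases hp : X.chord (X.step ∅ p) ∈ S
      · rw [X.step_of_mem S p hp] at this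
        rw [g_mate _ hp] at this
        have := f_step_in S p hp
        grind
      · rw [X.step_of_notMem S p hp] at this
        rw [this, f_step_out S p hp]
    intro p hp
    have h1 := (X.connected p (X.mate p)).apply_eq_of_invariant hconst
    have h2 := g_mate p hp
    simp only [Pi.add_apply] at h1
    grind
  -- At an inner end of `S`, arriving and jumping each change the inner sum by one. At any other end
  -- of `S` neither does: the change of the full sum across the chord is already that of the
  -- remaining sum.
  have f_inv : ∀ p, f (S ∩ X.inner) (X.step S p) = f (S ∩ X.inner) p := by
    refine X.step_invariant (fun p hp => ?_) (fun p hp => f_step_out _ p fun h' => hp h'.1)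
    by_cases hi : X.chord (X.step ∅ p) ∈ X.inner
    · have h1 := f_step_in (S ∩ X.inner) p ⟨hp, hi⟩
      have h2 := f_mate_in (S ∩ X.inner)
        (fun c hc d hd => iff_of_true hc.2 hd.2) (X.step ∅ p) ⟨hp, hi⟩
      grind
    · have h1 := f_step_out (S ∩ X.inner) p (fun h' => hi h'.2)
      have h2 := f_mate_in (S \ X.inner)
        (fun c hc d hd => iff_of_false hc.2 hd.2) (X.step ∅ p) ⟨hp, hi⟩
      have h3 := f_all _ hp
      have h4 := f_add X.inner (X.step ∅ p)
      have h5 := f_add X.inner (X.mate (X.step ∅ p))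
      grind
  -- The inner sum distinguishes the ends of inner chords but not of the others; by `inv` both kinds
  -- cannot occur.
  have same : ∀ p q, X.chord p ∈ S → X.chord q ∈ S → X.chord p ∈ X.inner →
      X.chord q ∈ X.inner := by
    intro p q hp hq hpi
    by_contra hqi
    have h1 := f_mate_in (S ∩ X.inner) (fun c hc d hd => iff_of_true hc.2 hd.2) p ⟨hp, hpi⟩
    have h2 := f_mate_in (S \ X.inner) (fun c hc d hd => iff_of_false hc.2 hd.2) q ⟨hq, hqi⟩
    have h3 := f_all _ hq
    have h4 := f_add X.inner q
    have h5 := f_add X.inner (X.mate q)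
    have h6 := inv _ f_inv q p hq hp (by grind)
    grind
  intro c hc d hd
  obtain ⟨p, rfl⟩ := X.chord_surjective c
  obtain ⟨q, rfl⟩ := X.chord_surjective d
  by_contra hpq
  have hside : ∀ r, X.chord r ∈ S → X.chord r ≠ X.chord p →
      X.side (X.chord p) (X.mate r) = X.side (X.chord p) r := fun r hr hrp =>
    X.side_mate _ _ hrp ⟨same r p hr hc, same p r hc hr⟩
  -- With one kind only, the side function of a single chord is itself invariant, yet it
  -- distinguishes the ends of that chord alone.
  have hinv : ∀ r, X.side (X.chord p) (X.step S r) = X.side (X.chord p) r := by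
    refine X.step_invariant (fun r hr => ?_) (fun r hr => X.side_step _ _ ?_)
    · by_cases hrp : X.chord (X.step ∅ r) = X.chord p
      · have h1 := X.side_step_chord r
        have h2 := X.side_mate_chord (X.step ∅ r)
        rw [hrp] at h1 h2
        grind
      · have h1 := X.side_step _ r hrp
        have h2 := hside _ hr hrp
        grind
    · rintro h'
      exact hr (h' ▸ hc)
  have h1 := inv _ hinv q p hd hc (hside q hd (Ne.symm hpq))
  have h2 := X.side_mate_chord p
  grind

/-- The circles are the two arcs of the chord. One has the base point and an end of side `0`, the
other only an end of side `1`. -/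
theorem total_singleton {S : Set κ} {x : α} (hS : S = {X.chord x})
    (h : ¬ (X.step S).SameCycle x (X.mate x)) : X.total S S x = 1 := by
  classical
  have hx : X.chord x ∈ S := by simp [hS]
  have hdiff : S \ {X.chord x} = ∅ := by simp [hS]
  have hinv : ∀ r, X.side (X.chord x) (X.step S r) = X.side (X.chord x) r := by
    refine X.step_invariant (fun r hr => ?_) (fun r hr => X.side_step _ _ fun h' => hr (h' ▸ hx))
    have h1 := X.side_step_chord r
    have h2 := X.side_mate_chord (X.step ∅ r)
    rw [show X.chord (X.step ∅ r) = X.chord x by simpa [hS] using hr] at h1 h2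
    grind
  have hb := (X.step_diff_sameCycle_iff (p := X.base) hx h).1 (by
    rw [hdiff]
    exact X.connected _ _)
  have htot : X.total S ∅ x = if (X.step S).SameCycle x X.base then 1 else 0 := by
    rw [total, Finset.sum_eq_single X.base]
    · simp [weight]
    · intro p _ hp
      simp [weight, hp]
    · simp
  rw [X.total_eq_diff S hx, if_pos (SameCycle.refl _ _), if_neg h, hdiff, htot]
  rcases hb with hb | hb
  · rw [if_pos hb, hb.apply_eq_of_invariant hinv, X.side_base, add_zero, add_zero]
  · have h1 := hb.apply_eq_of_invariant hinv
    rw [X.side_mate_chord, X.side_base] at h1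
    rw [if_neg fun h' => h (h'.trans hb.symm)]
    grind

/-- Every circle of every smoothing has odd total weight. -/
theorem total_eq_one [Finite κ] (S : Set κ) (z : α) : X.total S S z = 1 := by
  classical
  induction S using WellFoundedLT.induction generalizing z with
  | ind S ih =>
  have hlt : ∀ {c}, c ∈ S → S \ {c} < S := fun {c} hc =>
    Set.sdiff_singleton_ssubset.2 hc
  -- Circles that miss a chord.
  have miss : ∀ {z x}, X.chord x ∈ S → ¬ (X.step S).SameCycle z x →
      ¬ (X.step S).SameCycle z (X.mate x) → X.total S S z = 1 := fun hx h1 h2 => by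
    rw [X.total_of_not_touch hx h1 h2, ih _ (hlt hx)]
  have total_eq : ∀ {y z}, (X.step S).SameCycle y z → X.total S S y = X.total S S z :=
    fun h => X.total_congr (fun p => ⟨h.symm.trans, h.trans⟩) fun _ _ => rfl
  by_cases htwice : ∃ x, X.chord x ∈ S ∧ (X.step S).SameCycle z x ∧
      (X.step S).SameCycle z (X.mate x)
  · obtain ⟨x, hx, h1, h2⟩ := htwice
    rw [total_eq h1, X.total_of_touch_twice hx (h1.symm.trans h2), ih _ (hlt hx), ih _ (hlt hx)]
    decide
  by_cases hmiss : ∃ x, X.chord x ∈ S ∧ ¬ (X.step S).SameCycle z x ∧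
      ¬ (X.step S).SameCycle z (X.mate x)
  · obtain ⟨x, hx, h1, h2⟩ := hmiss
    exact miss hx h1 h2
  -- From here on every chord of `S` has exactly one end on the circle of `z`.
  push Not at htwice hmiss
  rcases S.eq_empty_or_nonempty with rfl | ⟨c, hc⟩
  · exact X.total_empty z
  obtain ⟨x, hx, hzx⟩ : ∃ x, X.chord x ∈ S ∧ (X.step S).SameCycle z x := by
    obtain ⟨x, rfl⟩ := X.chord_surjective c
    by_cases h : (X.step S).SameCycle z x
    · exact ⟨x, hc, h⟩
    · exact ⟨X.mate x, by rwa [X.chord_mate], hmiss x hc h⟩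
  have hzx' := htwice x hx hzx
  have hxx' : ¬ (X.step S).SameCycle x (X.mate x) := fun h => hzx' (hzx.trans h)
  -- If the circle at the other end misses a chord, its total is known, and merging the two circles
  -- determines the total at `z`.
  by_cases hother : ∃ y, X.chord y ∈ S ∧ ¬ (X.step S).SameCycle (X.mate x) y ∧
      ¬ (X.step S).SameCycle (X.mate x) (X.mate y)
  · obtain ⟨y, hy, h1, h2⟩ := hother
    have h3 := X.total_of_touch_once hx hxx'
    rw [miss hy h1 h2, ih _ (hlt hx)] at h3
    rw [total_eq hzx]
    grind
  · push Not at hother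
    have hsub : S.Subsingleton := by
      refine X.subsingleton_of_join (x := x) (y := X.mate x) (fun p hp => ?_) hxx'
      by_cases hp' : (X.step S).SameCycle z p
      · refine Or.inl ⟨hzx.symm.trans hp', hother p hp fun h => ?_⟩
        exact hzx' (hp'.trans h.symm)
      · refine Or.inr ⟨?_, hzx.symm.trans (hmiss p hp hp')⟩
        by_contra h
        exact hzx' ((hmiss p hp hp').trans (hother p hp h).symm)
    rw [total_eq hzx]
    exact X.total_singleton (hsub.eq_singleton_of_mem hx) hxx'

open Classical in
-- The ends of `c` have opposite sides, whose representatives `0` and `1` add up to exactly `1` in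
-- `ℤ`.
theorem sum_intWeight_insert {S : Set κ} {c : κ} (hc : c ∉ S) {Q : α → Prop}
    (hQ : ∀ p, X.chord p = c → Q p) :
    (∑ p, if Q p then X.intWeight (insert c S) p else 0) =
      (∑ p, if Q p then X.intWeight S p else 0) + 1 := by
  obtain ⟨x, rfl⟩ := X.chord_surjective c
  have key : ∀ p, (if Q p then X.intWeight (insert (X.chord x) S) p else 0) =
      (if Q p then X.intWeight S p else 0) +
      ((if p = x then ((X.side (X.chord x) x).val : ℤ) else 0) +
      if p = X.mate x then ((X.side (X.chord x) (X.mate x)).val : ℤ) else 0) := by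
    intro p
    rcases eq_or_ne p x with rfl | h1
    · simp [hQ p rfl, (X.mate_ne p).symm, X.intWeight_insert hc]
    rcases eq_or_ne p (X.mate x) with rfl | h2
    · have := X.intWeight_insert (S := S) (p := X.mate x) (by rwa [X.chord_mate])
      rw [X.chord_mate] at this
      simp [hQ _ (X.chord_mate x), h1, this]
    · rw [X.intWeight_insert_of_ne]
      · simp [h1, h2]
      · intro h
        rcases X.eq_or_eq_mate x p h.symm with h | h
        exacts [h1 h, h2 h]
  have hval : ∀ a : ZMod 2, (a.val : ℤ) + ((a + 1).val : ℤ) = 1 := by decide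
  rw [Finset.sum_congr rfl fun p _ => key p, Finset.sum_add_distrib, Finset.sum_add_distrib,
    Finset.sum_ite_eq', Finset.sum_ite_eq', if_pos (Finset.mem_univ _),
    if_pos (Finset.mem_univ _), X.side_mate_chord, hval]

end ChordDiagram

/-! ### Counting cycles under several transpositions -/

namespace Equiv.Perm

variable {α : Type*}

theorem numCycles_eq_of_sameCycle_iff {φ ψ : Perm α} (e : Perm α)
    (h : ∀ p q, φ.SameCycle p q ↔ ψ.SameCycle (e p) (e q)) : numCycles φ = numCycles ψ :=
  Nat.card_congr (Quotient.congr e h)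

section Transpositions

variable {κ : Type*} [DecidableEq κ] [DecidableEq α] [Finite α] {φ : Finset κ → Perm α}
  {x y : κ → α}

theorem numCycles_union_le (hφ : ∀ T c, c ∉ T → φ (insert c T) = swap (x c) (y c) * φ T)
    {R T : Finset κ} (hR : _root_.Disjoint R T) :
    numCycles (φ (R ∪ T)) ≤ numCycles (φ T) + R.card := by
  induction R using Finset.induction_on with
  | empty => simp
  | insert a R ha ih =>
    rw [Finset.disjoint_insert_left] at hR
    rw [Finset.insert_union, hφ _ _ (by simp [ha, hR.1]), Finset.card_insert_of_notMem ha]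
    exact numCycles_swap_mul_le_succ.trans (Nat.succ_le_succ (ih hR.2))

/-- Disjoint transpositions that create one cycle each split a cycle each, in any order. -/
theorem sameCycle_of_numCycles_ge [Fintype κ]
    (hφ : ∀ T c, c ∉ T → φ (insert c T) = swap (x c) (y c) * φ T)
    (hcount : numCycles (φ ∅) + Fintype.card κ ≤ numCycles (φ Finset.univ))
    {T : Finset κ} {c : κ} (hc : c ∉ T) : (φ T).SameCycle (x c) (y c) := by
  -- A transposition that creates no cycle is a loss that the others, each creating at most one,
  -- cannot make up.
  by_contra h
  have h1 := numCycles_swap_mul_le h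
  rw [← hφ T c hc] at h1
  have h2 := numCycles_union_le hφ (Finset.disjoint_empty_right T)
  have h3 := numCycles_union_le hφ (disjoint_compl_left (a := insert c T))
  rw [Finset.union_empty] at h2
  rw [Finset.union_comm, Finset.union_compl] at h3
  have h4 := Finset.card_add_card_compl (insert c T)
  rw [Finset.card_insert_of_notMem hc] at h4
  omega

end Transpositions

end Equiv.Perm

/-! ### Euler's formula and the number of faces -/

namespace PDCode

variable (D : PDCode.{u})

theorem two_mul_card_crossing_le_card_edge : 2 * Nat.card D.Crossing ≤ Nat.card D.Edge := by
  have : Finite D.Edge := inferInstanceAs (Finite (Quotient _))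
  have hH : Nat.card D.HalfEdge = Nat.card D.Crossing * 4 := by
    rw [Nat.card_prod, Nat.card_eq_fintype_card (α := ZMod 4), ZMod.card]
  let f : D.Edge × Bool → D.HalfEdge := fun e =>
    if e.2 then Quotient.out (s := SameCycle.setoid D.opp) e.1
    else D.opp (Quotient.out (s := SameCycle.setoid D.opp) e.1)
  have hf : Function.Surjective f := by
    intro h
    let e : D.Edge := Quotient.mk (SameCycle.setoid D.opp) h
    have he : D.opp.SameCycle (Quotient.out (s := SameCycle.setoid D.opp) e) h :=
      Quotient.exact (s := SameCycle.setoid D.opp) (Quotient.out_eq e)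
    have key : h = Quotient.out (s := SameCycle.setoid D.opp) e ∨
        h = D.opp (Quotient.out (s := SameCycle.setoid D.opp) e) := by
      generalize Quotient.out (s := SameCycle.setoid D.opp) e = k at he
      have := he.apply_eq_of_invariant (f := fun p => p = k ∨ p = D.opp k) fun p => by
        refine propext ⟨?_, ?_⟩
        · rintro (h | h)
          · exact Or.inr (by rw [← h, D.opp_opp])
          · exact Or.inl (D.opp.injective h)
        · rintro (h | h)
          · exact Or.inr (by rw [h])
          · exact Or.inl (by rw [h, D.opp_opp])
      exact this ▸ Or.inl rfl
    rcases key with h' | h'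
    · exact ⟨(e, true), h'.symm⟩
    · exact ⟨(e, false), h'.symm⟩
  have h1 := Nat.card_le_card_of_surjective f hf
  rw [hH, Nat.card_prod D.Edge, Nat.card_eq_fintype_card (α := Bool), Fintype.card_bool] at h1
  omega

theorem card_graphComponent_pos [Nonempty D.Crossing] : 0 < Nat.card D.GraphComponent := by
  have : Finite D.GraphComponent := inferInstanceAs (Finite (Quot _))
  have : Nonempty D.GraphComponent := ⟨Quot.mk _ (Classical.arbitrary _, 0)⟩
  exact Nat.card_pos

/-- Euler's formula with `E ≥ 2V` and at least one component. -/
theorem IsPlanar.card_face_ge {D : PDCode.{u}} (hD : D.IsPlanar) [Nonempty D.Crossing] :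
    Nat.card D.Crossing + 2 ≤ numCycles (D.rot * D.opp) := by
  have h1 := D.two_mul_card_crossing_le_card_edge
  have h2 := D.card_graphComponent_pos
  have h3 : numCycles (D.rot * D.opp) = Nat.card D.Face := rfl
  unfold IsPlanar at hD
  omega

/-- Conjugation by `opp` turns one permutation into the inverse of the other: faces are traversed
backwards. -/
theorem numCycles_rot_inv_mul_opp : numCycles (D.rot⁻¹ * D.opp) = numCycles (D.rot * D.opp) := by
  refine numCycles_eq_of_sameCycle_iff D.opp fun p q => ?_
  have h1 : D.opp⁻¹ = D.opp := by
    ext1 h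
    rw [Perm.inv_eq_iff_eq, D.opp_opp]
  have h2 : D.rot⁻¹ * D.opp = D.opp⁻¹ * (D.rot * D.opp)⁻¹ * D.opp⁻¹⁻¹ := by
    rw [mul_inv_rev, inv_inv]
    have h3 : D.opp * D.opp = 1 := Equiv.ext D.opp_opp
    rw [h1, ← mul_assoc, h3, one_mul]
  rw [h2, sameCycle_conj, sameCycle_inv, inv_inv]

end PDCode

/-! ### Directed walks along smoothings -/

namespace LinkDiagram

variable (D : LinkDiagram.{u})

open Classical in
/-- The involution that joins the half-edges at each crossing as in `D_S`. -/
noncomputable def smooth (S : D.State) : Perm D.HalfEdge :=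
  Function.Involutive.toPerm (fun h => (h.1, if h.1 ∈ S then 3 - h.2 else 1 - h.2)) fun h => by
    by_cases hS : h.1 ∈ S <;> simp [hS]

/-- Walking one step along `D_S`: cross an edge, then follow the smoothing. -/
noncomputable def walk (S : D.State) : Perm D.HalfEdge := D.smooth S * D.opp

variable {D}

theorem smooth_of_mem {S : D.State} {h : D.HalfEdge} (hS : h.1 ∈ S) :
    D.smooth S h = (h.1, 3 - h.2) := by
  exact Prod.ext rfl (if_pos hS)

theorem smooth_of_notMem {S : D.State} {h : D.HalfEdge} (hS : h.1 ∉ S) :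
    D.smooth S h = (h.1, 1 - h.2) := by
  exact Prod.ext rfl (if_neg hS)

theorem smooth_empty (h : D.HalfEdge) : D.smooth ∅ h = (h.1, 1 - h.2) :=
  smooth_of_notMem (Set.notMem_empty _)

theorem smooth_smooth (S : D.State) (h : D.HalfEdge) : D.smooth S (D.smooth S h) = h := by
  by_cases hS : h.1 ∈ S
  · rw [smooth_of_mem (by rwa [smooth_of_mem hS]), smooth_of_mem hS, sub_sub_cancel]
  · rw [smooth_of_notMem (by rwa [smooth_of_notMem hS]), smooth_of_notMem hS, sub_sub_cancel]

theorem walk_apply (S : D.State) (h : D.HalfEdge) : D.walk S h = D.smooth S (D.opp h) := rfl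

theorem walk_opp (S : D.State) (h : D.HalfEdge) : D.walk S (D.opp h) = D.smooth S h := by
  rw [walk_apply, D.opp_opp]

theorem sameCycle_walk_opp {S : D.State} {h k : D.HalfEdge} (hk : (D.walk S).SameCycle h k) :
    (D.walk S).SameCycle (D.opp h) (D.opp k) := by
  refine ((hk.symm.apply_eq_of_invariant
    (f := fun p => (D.walk S).SameCycle (D.opp p) (D.opp k)) fun p => propext ?_).mp
      (SameCycle.refl _ _))
  rw [← sameCycle_apply_left (x := D.opp (D.walk S p)), walk_opp, walk_apply, smooth_smooth]

theorem of_circle_eq {S : D.State} {F : D.HalfEdge → Prop} (hopp : ∀ k, F k → F (D.opp k))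
    (hsm : ∀ k, F k → F (D.smooth S k)) {h k : D.HalfEdge}
    (hk : (Quot.mk (D.Joined S) (Sum.inl h) : D.Circle S) = Quot.mk (D.Joined S) (Sum.inl k))
    (hF : F h) : F k := by
  have hsm' : ∀ k, F k = F (D.smooth S k) := fun k =>
    propext ⟨hsm k, fun hk => by simpa [smooth_smooth] using hsm _ hk⟩
  -- The value on loops is immaterial, as `Joined` relates no loop to anything.
  let G : D.Circle S → Prop := Quot.lift (Sum.elim F fun _ => True) (by
    rintro _ _ (k | ⟨c, hc, i⟩ | ⟨c, hc, i⟩)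
    · exact propext ⟨hopp k, fun hk => by simpa [D.opp_opp] using hopp _ hk⟩
    · exact (hsm' (c, i)).trans (by rw [smooth_of_notMem hc]; rfl)
    · exact (hsm' (c, i)).trans (by rw [smooth_of_mem hc]; rfl))
  exact (congrArg G hk).mp hF

/-- In a connected smoothing every half-edge lies on one of the two directed walks. -/
theorem sameCycle_or_of_connected {S : D.State} (hD : D.SmoothingConnected S)
    (h k : D.HalfEdge) : (D.walk S).SameCycle h k ∨ (D.walk S).SameCycle (D.opp h) k := by
  have hopp : ∀ k, (D.walk S).SameCycle h k ∨ (D.walk S).SameCycle (D.opp h) k →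
      (D.walk S).SameCycle h (D.opp k) ∨ (D.walk S).SameCycle (D.opp h) (D.opp k) := by
    rintro k (hk | hk)
    · exact Or.inr (sameCycle_walk_opp hk)
    · exact Or.inl (by simpa [D.opp_opp] using sameCycle_walk_opp hk)
  have hsub : Subsingleton (D.Circle S) := (Nat.card_eq_one_iff_unique.1 hD).1
  refine of_circle_eq (S := S) hopp (fun k hk => ?_) (hsub.elim _ _)
    (Or.inl (SameCycle.refl _ h))
  rw [← walk_opp]
  exact (hopp k hk).imp sameCycle_apply_right.2 sameCycle_apply_right.2

theorem numCycles_walk_le_two {S : D.State} (hD : D.SmoothingConnected S)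
    [Nonempty D.Crossing] : numCycles (D.walk S) ≤ 2 := by
  let h : D.HalfEdge := (Classical.arbitrary _, 0)
  have := Nat.card_le_card_of_surjective
    (fun b : Bool => Quotient.mk (SameCycle.setoid (D.walk S)) (if b then h else D.opp h))
    (fun q => by
      obtain ⟨k, rfl⟩ := Quotient.exists_rep q
      rcases sameCycle_or_of_connected hD h k with hk | hk
      · exact ⟨true, Quotient.sound hk⟩
      · exact ⟨false, Quotient.sound hk⟩)
  rwa [Nat.card_eq_fintype_card (α := Bool), Fintype.card_bool] at this

open Classical in
/-- At the crossings of `T`, exchange the half-edge `η` with the opposite one. -/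
noncomputable def cross (D : LinkDiagram.{u}) (η : ZMod 4) (T : Finset D.Crossing) :
    Perm D.HalfEdge :=
  Function.Involutive.toPerm
    (fun h => if h.1 ∈ T ∧ (h.2 = η ∨ h.2 = η + 2) then (h.1, h.2 + 2) else h) fun h => by
    obtain ⟨c, i⟩ := h
    by_cases hc : c ∈ T
    · simp only [hc, true_and]
      by_cases hi : i = η ∨ i = η + 2
      · have h4 : i + 2 = η ∨ i + 2 = η + 2 := by revert i η; decide
        rw [if_pos hi, if_pos ⟨hc, h4⟩]
        simp only [Prod.mk.injEq, true_and]
        clear hi h4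
        revert i; decide
      · rw [if_neg hi, if_neg fun h => hi h.2]
    · simp [hc]

theorem cross_apply_of_notMem (η : ZMod 4) {T : Finset D.Crossing} {h : D.HalfEdge}
    (hT : h.1 ∉ T) : D.cross η T h = h :=
  if_neg fun h' => hT h'.1

open Classical in
theorem cross_apply_of_mem (η : ZMod 4) {T : Finset D.Crossing} {h : D.HalfEdge}
    (hT : h.1 ∈ T) :
    D.cross η T h = if h.2 = η ∨ h.2 = η + 2 then (h.1, h.2 + 2) else h := by
  change (if _ then _ else _) = _
  simp only [hT, true_and]

theorem cross_empty (η : ZMod 4) : D.cross η ∅ = 1 := by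
  ext1 h
  exact cross_apply_of_notMem η (Finset.notMem_empty _)

open Classical in
theorem cross_insert (η : ZMod 4) {T : Finset D.Crossing} {c : D.Crossing} (hc : c ∉ T) :
    D.cross η (insert c T) = swap (c, η) (c, η + 2) * D.cross η T := by
  ext1 ⟨d, i⟩
  rw [mul_apply]
  by_cases hd : d = c
  · subst hd
    rw [cross_apply_of_mem _ (by simp), cross_apply_of_notMem _ hc, swap_apply_def]
    simp only [Prod.mk.injEq, true_and]
    have h4 : η + 2 + 2 = η := by revert η; decide
    split_ifs with h1 h2 h3 h5 h6 <;> simp_all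
  · have h1 : ∀ j k, ((d, j) : D.HalfEdge) ≠ (c, k) := fun j k h => hd (congrArg Prod.fst h)
    by_cases hT : d ∈ T
    · rw [cross_apply_of_mem _ (by simp [hT]), cross_apply_of_mem _ hT]
      split_ifs <;> exact (swap_apply_of_ne_of_ne (h1 _ _) (h1 _ _)).symm
    · rw [cross_apply_of_notMem _ (by simp [hd, hT]), cross_apply_of_notMem _ hT,
        swap_apply_of_ne_of_ne (h1 _ _) (h1 _ _)]

theorem rot_apply (h : D.HalfEdge) : D.rot h = (h.1, h.2 + 1) := rfl

/-- Exchanging opposite half-edges everywhere turns the walk along `D_∅` into the face permutation.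
-/
theorem cross_univ_zero [Fintype D.Crossing] : D.cross 0 Finset.univ * D.smooth ∅ = D.rot := by
  ext1 ⟨c, i⟩
  rw [mul_apply, smooth_empty, cross_apply_of_mem _ (Finset.mem_univ _), rot_apply]
  revert i
  simp only [← apply_ite (Prod.mk c), Prod.mk.injEq, true_and]
  decide

theorem cross_univ_one [Fintype D.Crossing] : D.cross 1 Finset.univ * D.smooth ∅ = D.rot⁻¹ := by
  ext1 ⟨c, i⟩
  rw [Perm.eq_inv_iff_eq, mul_apply, smooth_empty, cross_apply_of_mem _ (Finset.mem_univ _)]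
  simp only [← apply_ite (Prod.mk c), rot_apply, Prod.mk.injEq, true_and]
  revert i
  decide

theorem numCycles_cross_univ_ge [Fintype D.Crossing] [Nonempty D.Crossing] {η : ZMod 4}
    (hη : η = 0 ∨ η = 1) :
    Fintype.card D.Crossing + 2 ≤ numCycles (D.cross η Finset.univ * D.walk ∅) := by
  have h := D.planar.card_face_ge
  rw [Nat.card_eq_fintype_card] at h
  rw [walk, ← mul_assoc]
  rcases hη with rfl | rfl
  · rwa [cross_univ_zero]
  · rwa [cross_univ_one, PDCode.numCycles_rot_inv_mul_opp]

open Classical in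
theorem cross_insert_mul (η : ZMod 4) (T : Finset D.Crossing) (c : D.Crossing) (hc : c ∉ T) :
    D.cross η (insert c T) * D.walk ∅ =
      swap (c, η) (c, η + 2) * (D.cross η T * D.walk ∅) := by
  rw [cross_insert η hc, mul_assoc]

theorem sameCycle_cross [Nonempty D.Crossing] (hD : D.SmoothingConnected ∅) {η : ZMod 4}
    (hη : η = 0 ∨ η = 1) {T : Finset D.Crossing} {c : D.Crossing} (hc : c ∉ T) :
    (D.cross η T * D.walk ∅).SameCycle (c, η) (c, η + 2) := by
  classical
  have := Fintype.ofFinite D.Crossing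
  refine sameCycle_of_numCycles_ge (φ := fun T => D.cross η T * D.walk ∅)
    (x := fun c => (c, η)) (y := fun c => (c, η + 2)) (cross_insert_mul η) ?_ hc
  have h1 := numCycles_cross_univ_ge (D := D) hη
  have h2 := numCycles_walk_le_two hD
  rw [cross_empty, one_mul]
  omega

theorem sameCycle_walk [Nonempty D.Crossing] (hD : D.SmoothingConnected ∅) {η : ZMod 4}
    (hη : η = 0 ∨ η = 1) (c : D.Crossing) : (D.walk ∅).SameCycle (c, η) (c, η + 2) := by
  simpa [cross_empty] using sameCycle_cross hD hη (Finset.notMem_empty c)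

open Classical in
-- After cutting at `c`, the two ends at `d` still lie on one cycle: the chords do not cross.
theorem sameCycle_swap_walk [Nonempty D.Crossing] (hD : D.SmoothingConnected ∅) {η : ZMod 4}
    (hη : η = 0 ∨ η = 1) {c d : D.Crossing} (hcd : d ≠ c) :
    (swap (c, η) (c, η + 2) * D.walk ∅).SameCycle (d, η) (d, η + 2) := by
  have := sameCycle_cross hD hη (Finset.notMem_singleton.2 hcd)
  rwa [← insert_empty_eq, cross_insert η (Finset.notMem_empty c), cross_empty, mul_one] at this

/-- Otherwise the walk is a single cycle, and `V` transpositions yield at most `V + 1` cycles, fewer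
than the faces. -/
theorem not_sameCycle_opp [Nonempty D.Crossing] (hD : D.SmoothingConnected ∅) (h : D.HalfEdge) :
    ¬ (D.walk ∅).SameCycle h (D.opp h) := by
  classical
  have := Fintype.ofFinite D.Crossing
  intro hh
  have hone : numCycles (D.walk ∅) ≤ 1 := by
    have hle := Nat.card_le_card_of_surjective
      (fun _ : Unit => Quotient.mk (SameCycle.setoid (D.walk ∅)) h)
      (fun q => by
        obtain ⟨k, rfl⟩ := Quotient.exists_rep q
        rcases sameCycle_or_of_connected hD h k with hk | hk
        · exact ⟨(), Quotient.sound hk⟩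
        · exact ⟨(), Quotient.sound (hh.trans hk)⟩)
    rwa [Nat.card_unique (α := Unit)] at hle
  have h1 := numCycles_union_le (φ := fun T => D.cross 0 T * D.walk ∅)
    (x := fun c => (c, 0)) (y := fun c => (c, 0 + 2)) (cross_insert_mul 0)
    (Finset.disjoint_empty_right Finset.univ)
  have h2 := numCycles_cross_univ_ge (D := D) (Or.inl rfl)
  rw [Finset.union_empty, Finset.card_univ, cross_empty, one_mul] at h1
  omega

end LinkDiagram

/-! ### The chord diagram of a connected smoothing -/

namespace LinkDiagram

variable {D : LinkDiagram.{u}}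

/-- The half-edges whose outward direction agrees with that of `b` along the circle `D_∅`. -/
abbrev Coherent (b : D.HalfEdge) : Type u := {h : D.HalfEdge // (D.walk ∅).SameCycle b h}

theorem coherent_opp_iff
    [Nonempty D.Crossing] (hD : D.SmoothingConnected ∅) (b : D.HalfEdge) (h : D.HalfEdge) :
    (D.walk ∅).SameCycle b (D.opp h) ↔ ¬ (D.walk ∅).SameCycle b h := by
  constructor
  · exact fun h1 h2 => not_sameCycle_opp hD h (h2.symm.trans h1)
  · intro h1
    rcases sameCycle_or_of_connected hD b h with h2 | h2
    · exact absurd h2 h1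
    · simpa [D.opp_opp] using sameCycle_walk_opp h2

theorem coherent_smooth_empty_iff
    [Nonempty D.Crossing] (hD : D.SmoothingConnected ∅) (b : D.HalfEdge) (h : D.HalfEdge) :
    (D.walk ∅).SameCycle b (D.smooth ∅ h) ↔ ¬ (D.walk ∅).SameCycle b h := by
  rw [← walk_opp, sameCycle_apply_right, coherent_opp_iff hD]

/-- This makes the direction of `D_∅` compatible with `1`-smoothings, whose arcs differ from those
of `0`-smoothings by a half-turn at one end. -/
theorem coherent_add_two_iff
    [Nonempty D.Crossing] (hD : D.SmoothingConnected ∅) (b : D.HalfEdge) (c : D.Crossing) (i : ZMod 4) :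
    (D.walk ∅).SameCycle b (c, i + 2) ↔ (D.walk ∅).SameCycle b (c, i) := by
  have h0 := sameCycle_walk hD (Or.inl rfl) c
  have h1 := sameCycle_walk hD (Or.inr rfl) c
  have key : ∀ {h k : D.HalfEdge}, (D.walk ∅).SameCycle h k →
      ((D.walk ∅).SameCycle b k ↔ (D.walk ∅).SameCycle b h) :=
    fun h => ⟨fun h' => h'.trans h.symm, fun h' => h'.trans h⟩
  have h4 : ∀ j : ZMod 4, j + 2 + 2 = j := by decide
  have hi : i = 0 ∨ i = 1 ∨ i = 0 + 2 ∨ i = 1 + 2 := by revert i; decide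
  rcases hi with rfl | rfl | rfl | rfl
  · exact key h0
  · exact key h1
  · exact key (by rw [h4]; exact h0.symm)
  · exact key (by rw [h4]; exact h1.symm)

theorem coherent_smooth_iff
    [Nonempty D.Crossing] (hD : D.SmoothingConnected ∅) (b : D.HalfEdge) (S : D.State) (h : D.HalfEdge) :
    (D.walk ∅).SameCycle b (D.smooth S h) ↔ ¬ (D.walk ∅).SameCycle b h := by
  by_cases hS : h.1 ∈ S
  · rw [smooth_of_mem hS, ← coherent_smooth_empty_iff hD, smooth_empty,
      ← coherent_add_two_iff hD b h.1 (1 - h.2), show (1 : ZMod 4) - h.2 + 2 = 3 - h.2 by ring]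
  · rw [smooth_of_notMem hS, ← smooth_empty, coherent_smooth_empty_iff hD]

theorem coherent_walk_iff
    [Nonempty D.Crossing] (hD : D.SmoothingConnected ∅) (b : D.HalfEdge) (S : D.State) (h : D.HalfEdge) :
    (D.walk ∅).SameCycle b (D.walk S h) ↔ (D.walk ∅).SameCycle b h := by
  rw [walk_apply, coherent_smooth_iff hD, coherent_opp_iff hD, not_not]

theorem coherent_one_iff
    [Nonempty D.Crossing] (hD : D.SmoothingConnected ∅) (b : D.HalfEdge) (c : D.Crossing) :
    (D.walk ∅).SameCycle b (c, 1) ↔ ¬ (D.walk ∅).SameCycle b (c, 0) := by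
  rw [← coherent_smooth_empty_iff hD, smooth_empty, sub_zero]

open Classical in
/-- The first coherent half-edge at a crossing. -/
noncomputable def firstEnd (b : D.HalfEdge) (c : D.Crossing) : ZMod 4 :=
  if (D.walk ∅).SameCycle b (c, 0) then 0 else 1

theorem firstEnd_eq (b : D.HalfEdge) (c : D.Crossing) : firstEnd b c = 0 ∨ firstEnd b c = 1 := by
  unfold firstEnd
  split_ifs <;> simp

theorem coherent_iff
    [Nonempty D.Crossing] (hD : D.SmoothingConnected ∅) (b : D.HalfEdge) (c : D.Crossing) (i : ZMod 4) :
    (D.walk ∅).SameCycle b (c, i) ↔ i = firstEnd b c ∨ i = firstEnd b c + 2 := by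
  have h1 := coherent_one_iff hD b c
  have h2 := coherent_add_two_iff hD b c 0
  have h3 := coherent_add_two_iff hD b c 1
  unfold firstEnd
  have hi : i = 0 ∨ i = 1 ∨ i = 0 + 2 ∨ i = 1 + 2 := by revert i; decide
  by_cases h0 : (D.walk ∅).SameCycle b (c, 0)
  · rw [if_pos h0]
    rcases hi with rfl | rfl | rfl | rfl
    · simp [h0]
    · exact iff_of_false (fun h => h1.1 h h0) (by decide)
    · exact iff_of_true (h2.2 h0) (by decide)
    · exact iff_of_false (fun h => h1.1 (h3.1 h) h0) (by decide)
  · rw [if_neg h0]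
    rcases hi with rfl | rfl | rfl | rfl
    · exact iff_of_false h0 (by decide)
    · exact iff_of_true (h1.2 h0) (by decide)
    · exact iff_of_false (fun h => h0 (h2.1 h)) (by decide)
    · exact iff_of_true (h3.2 (h1.2 h0)) (by decide)

open Classical in
/-- The `1`-smoothing of `D_∅` at the single crossing `c`, on coherent half-edges. -/
noncomputable def splitWalk (b : D.HalfEdge) (c : D.Crossing) : Perm D.HalfEdge :=
  swap (c, firstEnd b c) (c, firstEnd b c + 2) * D.walk ∅

open Classical in
/-- The indicator of the circle of `splitWalk` through the first end of `c`. -/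
noncomputable def arc (b : D.HalfEdge) (c : D.Crossing) (h : D.HalfEdge) : ZMod 2 :=
  if (splitWalk b c).SameCycle (c, firstEnd b c) h then 1 else 0

theorem firstEnd_ne (b : D.HalfEdge) (c : D.Crossing) :
    ((c, firstEnd b c) : D.HalfEdge) ≠ (c, firstEnd b c + 2) := by
  intro h
  have h2 := (Prod.mk.inj h).2
  generalize firstEnd b c = i at h2
  revert i
  decide

theorem arc_splitWalk (b : D.HalfEdge) (c : D.Crossing) (h : D.HalfEdge) :
    arc b c (splitWalk b c h) = arc b c h := by
  rw [arc, arc, sameCycle_apply_right]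

theorem arc_firstEnd (b : D.HalfEdge) (c : D.Crossing) : arc b c (c, firstEnd b c) = 1 :=
  if_pos (SameCycle.refl _ _)

theorem arc_lastEnd
    [Nonempty D.Crossing] (hD : D.SmoothingConnected ∅) (b : D.HalfEdge) (c : D.Crossing) : arc b c (c, firstEnd b c + 2) = 0 := by
  classical
  exact if_neg (not_sameCycle_swap_mul (firstEnd_ne b c)
    (sameCycle_walk hD (firstEnd_eq b c) c))

theorem arc_add_two
    [Nonempty D.Crossing] (hD : D.SmoothingConnected ∅) (b : D.HalfEdge) {c : D.Crossing} {i : ZMod 4} (hi : (D.walk ∅).SameCycle b (c, i)) :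
    arc b c (c, i + 2) = arc b c (c, i) + 1 := by
  rcases (coherent_iff hD b c i).1 hi with rfl | rfl
  · rw [arc_firstEnd, arc_lastEnd hD]
    decide
  · rw [add_assoc, show (2 : ZMod 4) + 2 = 0 by decide, add_zero, arc_firstEnd, arc_lastEnd hD]
    decide

theorem arc_walk_of_ne (b : D.HalfEdge) {c : D.Crossing} {h : D.HalfEdge} (hc : (D.walk ∅ h).1 ≠ c) :
    arc b c (D.walk ∅ h) = arc b c h := by
  classical
  rw [← arc_splitWalk b c h, splitWalk, mul_apply, swap_apply_of_ne_of_ne]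
  · exact fun h' => hc (congrArg Prod.fst h')
  · exact fun h' => hc (congrArg Prod.fst h')

theorem arc_walk
    [Nonempty D.Crossing] (hD : D.SmoothingConnected ∅) (b : D.HalfEdge) {h : D.HalfEdge} (hh : (D.walk ∅).SameCycle b h) :
    arc b (D.walk ∅ h).1 (D.walk ∅ h) = arc b (D.walk ∅ h).1 h + 1 := by
  classical
  have hw := sameCycle_apply_right.2 hh
  rw [← arc_splitWalk b _ h, splitWalk, mul_apply]
  generalize D.walk ∅ h = k at hw
  obtain ⟨c, i⟩ := k
  dsimp only
  rcases (coherent_iff hD b c i).1 hw with rfl | rfl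
  · rw [swap_apply_left, arc_firstEnd, arc_lastEnd hD]
    decide
  · rw [swap_apply_right, arc_firstEnd, arc_lastEnd hD]
    decide

theorem arc_add_two_of_ne
    [Nonempty D.Crossing] (hD : D.SmoothingConnected ∅) (b : D.HalfEdge) {c d : D.Crossing} {i : ZMod 4} (hdc : d ≠ c)
    (hi : (D.walk ∅).SameCycle b (d, i))
    (h : (D.walk ∅).SameCycle b (d, 0) ↔ (D.walk ∅).SameCycle b (c, 0)) :
    arc b c (d, i + 2) = arc b c (d, i) := by
  classical
  -- Chords of the same kind have the same `η`, as `sameCycle_swap_walk` requires.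
  have hend : firstEnd b d = firstEnd b c := by simp [firstEnd, h]
  have h1 : arc b c (d, firstEnd b c) = arc b c (d, firstEnd b c + 2) :=
    SameCycle.apply_eq_of_invariant (arc_splitWalk b c)
      (sameCycle_swap_walk hD (firstEnd_eq b c) hdc)
  rcases (coherent_iff hD b d i).1 hi with rfl | rfl
  · rw [hend, h1]
  · rw [add_assoc, show (2 : ZMod 4) + 2 = 0 by decide, add_zero, hend, h1]

/-- The restriction of the directed walk along `D_S` to coherent half-edges. -/
noncomputable def coherentWalk
    [Nonempty D.Crossing] (hD : D.SmoothingConnected ∅) (b : D.HalfEdge) (S : D.State) : Perm (Coherent b) :=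
  (D.walk S).subtypePerm fun h => coherent_walk_iff hD b S h

theorem coherentWalk_apply
    [Nonempty D.Crossing] (hD : D.SmoothingConnected ∅) (b : D.HalfEdge) (S : D.State) (h : Coherent b) :
    (coherentWalk hD b S h : D.HalfEdge) = D.walk S h := rfl

theorem walk_of_mem {S : D.State} {h : D.HalfEdge} (hS : (D.walk ∅ h).1 ∈ S) :
    D.walk S h = ((D.walk ∅ h).1, (D.walk ∅ h).2 + 2) := by
  rw [walk_apply, smooth_empty] at hS
  rw [walk_apply, walk_apply ∅, smooth_empty,
    smooth_of_mem (h := D.opp h) hS]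
  simp only [Prod.mk.injEq, true_and]
  ring

theorem walk_of_notMem {S : D.State} {h : D.HalfEdge} (hS : (D.walk ∅ h).1 ∉ S) :
    D.walk S h = D.walk ∅ h := by
  rw [walk_apply, smooth_empty] at hS
  rw [walk_apply, walk_apply ∅, smooth_empty,
    smooth_of_notMem (h := D.opp h) hS]

/-- The chord diagram whose circle is `D_∅` and whose chords are the crossings. -/
noncomputable def chordDiagram
    [Nonempty D.Crossing] (hD : D.SmoothingConnected ∅) (b : D.HalfEdge) : ChordDiagram D.Crossing (Coherent b) where
  chord h := h.1.1
  chord_surjective c :=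
    ⟨⟨(c, firstEnd b c), (coherent_iff hD b c _).2 (Or.inl rfl)⟩, rfl⟩
  mate h := ⟨(h.1.1, h.1.2 + 2), (coherent_add_two_iff hD b _ _).2 h.2⟩
  chord_mate _ := rfl
  mate_ne h := by
    intro h'
    have h2 := congrArg (fun k : Coherent b => k.1.2) h'
    dsimp only at h2
    generalize h.1.2 = i at h2
    revert i
    decide
  eq_or_eq_mate p q h := by
    obtain ⟨⟨c, i⟩, hp⟩ := p
    obtain ⟨⟨d, j⟩, hq⟩ := q
    obtain rfl : c = d := h
    simp only [Subtype.mk.injEq, Prod.mk.injEq, true_and]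
    have h1 := (coherent_iff hD b c i).1 hp
    have h2 := (coherent_iff hD b c j).1 hq
    clear hp hq
    generalize firstEnd b c = k at h1 h2
    revert i j k
    decide
  step := coherentWalk hD b
  step_of_mem S p hS := Subtype.ext (walk_of_mem hS)
  step_of_notMem S p hS := Subtype.ext (walk_of_notMem hS)
  connected p q := by
    rw [coherentWalk, sameCycle_subtypePerm]
    exact p.2.symm.trans q.2
  -- The second term makes the side of the base point zero.
  side c h := arc b c h + arc b c b
  side_step_chord p := by
    rw [coherentWalk_apply, arc_walk hD b p.2]
    ring
  side_step c p h := by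
    rw [coherentWalk_apply, arc_walk_of_ne b h]
  side_mate_chord p := by
    rw [arc_add_two hD b p.2]
    ring
  inner := {c | (D.walk ∅).SameCycle b (c, 0)}
  side_mate c p h h' := by
    rw [arc_add_two_of_ne hD b h p.2 h']
  base := ⟨b, SameCycle.refl _ _⟩
  side_base c := CharTwo.add_self_eq_zero _

/-- The circles of `D_S` are the cycles of the walk on coherent half-edges. -/
theorem coherentWalk_sameCycle_iff [Nonempty D.Crossing] (hD : D.SmoothingConnected ∅) (b : D.HalfEdge)
    (S : D.State) (p q : Coherent b) :
    (coherentWalk hD b S).SameCycle p q ↔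
      (Quot.mk (D.Joined S) (Sum.inl p.1) : D.Circle S) = Quot.mk (D.Joined S) (Sum.inl q.1) := by
  classical
  have hopp : ∀ h : D.HalfEdge, (Quot.mk (D.Joined S) (Sum.inl (D.opp h)) : D.Circle S) =
      Quot.mk (D.Joined S) (Sum.inl h) := fun h => (Quot.sound (Joined.edge h)).symm
  have hsm : ∀ h : D.HalfEdge, (Quot.mk (D.Joined S) (Sum.inl (D.smooth S h)) : D.Circle S) =
      Quot.mk (D.Joined S) (Sum.inl h) := by
    intro h
    by_cases hS : h.1 ∈ S
    · rw [smooth_of_mem hS]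
      exact (Quot.sound (Joined.one_smoothing h.1 hS h.2)).symm
    · rw [smooth_of_notMem hS]
      exact (Quot.sound (Joined.zero_smoothing h.1 hS h.2)).symm
  constructor
  · intro h
    refine h.apply_eq_of_invariant
      (f := fun p => (Quot.mk (D.Joined S) (Sum.inl p.1) : D.Circle S)) fun p => ?_
    rw [coherentWalk_apply, walk_apply, hsm, hopp]
  · intro h
    rw [coherentWalk, sameCycle_subtypePerm]
    -- A circle consists of the half-edges on one directed walk and their opposites; coherence later
    -- excludes the opposites.
    have hsm' : ∀ h, (D.walk S).SameCycle p h ∨ (D.walk S).SameCycle p (D.opp h) →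
        (D.walk S).SameCycle p (D.smooth S h) ∨
          (D.walk S).SameCycle p (D.opp (D.smooth S h)) := by
      rintro h (hh | hh)
      · refine Or.inr ?_
        rw [← sameCycle_apply_right, walk_opp, smooth_smooth]
        exact hh
      · refine Or.inl ?_
        rw [← walk_opp, sameCycle_apply_right]
        exact hh
    rcases of_circle_eq (fun h hh => by simpa only [D.opp_opp] using hh.symm) hsm' h
      (Or.inl (SameCycle.refl _ _)) with hq | hq
    · exact hq
    · exfalso
      have := hq.apply_eq_of_invariant
        (f := (D.walk ∅).SameCycle b) fun h => propext (coherent_walk_iff hD b S h)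
      exact (coherent_opp_iff hD b q.1).1 (this.mp p.2) q.2

end LinkDiagram

/-! ### The twisting weight -/

namespace LinkDiagram

variable {D : LinkDiagram.{u}}

/-- Joins away from `c` are common to both states, and joins at `c` only relate pieces on circles at
`c`. Hence the circles at `c` cover the same pieces before and after a change at `c`. -/
theorem Adjacent.of_agree {S T : D.State} {c : D.Crossing} (hST : ∀ d, d ≠ c → (d ∈ S ↔ d ∈ T))
    {p : D.Piece} (h : Adjacent c (Quot.mk (D.Joined S) p : D.Circle S)) :
    Adjacent c (Quot.mk (D.Joined T) p : D.Circle T) := by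
  have hc : ∀ i, Adjacent c (Quot.mk (D.Joined T) (Sum.inl (c, i)) : D.Circle T) :=
    fun i => ⟨i, rfl⟩
  let G : D.Circle S → Prop :=
    Quot.lift (fun p => Adjacent c (Quot.mk (D.Joined T) p : D.Circle T)) (by
      rintro _ _ (k | ⟨d, hd, i⟩ | ⟨d, hd, i⟩)
      · exact congrArg (Adjacent c) (Quot.sound (Joined.edge k))
      · by_cases hdc : d = c
        · subst hdc
          exact propext (iff_of_true (hc _) (hc _))
        · exact congrArg (Adjacent c)
            (Quot.sound (Joined.zero_smoothing d (fun h => hd ((hST d hdc).2 h)) i))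
      · by_cases hdc : d = c
        · subst hdc
          exact propext (iff_of_true (hc _) (hc _))
        · exact congrArg (Adjacent c)
            (Quot.sound (Joined.one_smoothing d ((hST d hdc).1 hd) i)))
  obtain ⟨i, hi⟩ := h
  exact (congrArg G hi).mp (hc i)

theorem adjacent_insert_iff {S : D.State} {c : D.Crossing} (p : D.Piece) :
    Adjacent c (Quot.mk (D.Joined (insert c S)) p : D.Circle (insert c S)) ↔
      Adjacent c (Quot.mk (D.Joined S) p : D.Circle S) :=
  ⟨Adjacent.of_agree fun _ h => (Set.mem_insert_iff.trans (or_iff_right h)),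
    Adjacent.of_agree fun _ h => (Set.mem_insert_iff.trans (or_iff_right h)).symm⟩

section Weight

variable [Nonempty D.Crossing] (hD : D.SmoothingConnected ∅) (b : D.HalfEdge)

noncomputable instance : Fintype (Coherent b) := Fintype.ofFinite _

open Classical in
/-- The sum of the weights of the coherent half-edges in a set of pieces. -/
noncomputable def weightSum (P : Set D.Piece) (S : D.State) : ℤ :=
  ∑ p : Coherent b, if Sum.inl p.1 ∈ P then (chordDiagram hD b).intWeight S p else 0

theorem weightSum_union {P Q R : Set D.Piece} (S : D.State) (h : ∀ p, p ∈ P ↔ p ∈ Q ∨ p ∈ R)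
    (hd : ∀ p, p ∈ Q → p ∉ R) :
    weightSum hD b P S = weightSum hD b Q S + weightSum hD b R S := by
  rw [weightSum, weightSum, weightSum, ← Finset.sum_add_distrib]
  refine Finset.sum_congr rfl fun p _ => ?_
  have h1 := h (Sum.inl p.1)
  have h2 := hd (Sum.inl p.1)
  by_cases hQ : Sum.inl p.1 ∈ Q
  · rw [if_pos (h1.2 (Or.inl hQ)), if_pos hQ, if_neg (h2 hQ), add_zero]
  · by_cases hR : Sum.inl p.1 ∈ R
    · rw [if_pos (h1.2 (Or.inr hR)), if_neg hQ, if_pos hR, zero_add]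
    · rw [if_neg (fun hP => (h1.1 hP).elim hQ hR), if_neg hQ, if_neg hR, add_zero]

theorem weightSum_insert {P : Set D.Piece} {S : D.State} {c : D.Crossing} (hc : c ∉ S)
    (hP : ∀ i, Sum.inl (c, i) ∈ P) :
    weightSum hD b P (insert c S) = weightSum hD b P S + 1 := by
  refine (chordDiagram hD b).sum_intWeight_insert hc fun p hp => ?_
  obtain ⟨⟨d, i⟩, h⟩ := p
  obtain rfl : d = c := hp
  exact hP i

theorem weightSum_insert_of_notMem {P : Set D.Piece} {S : D.State} {c : D.Crossing}
    (hP : ∀ i, Sum.inl (c, i) ∉ P) :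
    weightSum hD b P (insert c S) = weightSum hD b P S := by
  refine Finset.sum_congr rfl fun p _ => ?_
  split_ifs with hp
  · refine (chordDiagram hD b).intWeight_insert_of_ne ?_
    rintro rfl
    exact hP p.1.2 hp
  · rfl

theorem odd_weightSum {S : D.State} {C : D.Circle S} {c : D.Crossing} (hC : Adjacent c C) :
    Odd (weightSum hD b C.pieces S) := by
  classical
  obtain ⟨z, rfl⟩ : ∃ z : Coherent b, Quot.mk (D.Joined S) (Sum.inl z.1) = C := by
    obtain ⟨i, hi⟩ := hC
    by_cases h : (D.walk ∅).SameCycle b (c, i)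
    · exact ⟨⟨_, h⟩, hi⟩
    · exact ⟨⟨_, (coherent_opp_iff hD b _).2 h⟩, (Quot.sound (Joined.edge _)).symm.trans hi⟩
  rw [← ZMod.intCast_eq_one_iff_odd, ← (chordDiagram hD b).total_eq_one S z, weightSum,
    ChordDiagram.total, Int.cast_sum]
  refine Finset.sum_congr rfl fun p _ => ?_
  rw [Int.cast_ite, Int.cast_zero, ChordDiagram.intCast_intWeight]
  have h := coherentWalk_sameCycle_iff hD b S z p
  by_cases hp : (coherentWalk hD b S).SameCycle z p
  · exact (if_pos (h.1 hp).symm).trans (if_pos hp).symm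
  · exact (if_neg fun h' => hp (h.2 h'.symm)).trans (if_neg hp).symm

/-- The sums satisfy `W(C₁) + W(C₂) = W(C) + 1` for a split and `W(C) = W(C₁) + W(C₂) + 1` for a
merger; oddness makes the integer division exact. An identified circle keeps its sum, so parity is
not needed there. -/
theorem isTwistingWeight_weightSum : D.IsTwistingWeight
    fun C => (1 + weightSum hD b C.2.pieces C.1) / 2 where
  split S c hc C C₁ C₂ h := by
    obtain ⟨h1, hne, h2⟩ := h
    obtain ⟨k, hk⟩ := odd_weightSum hD b ((h1 C).2 rfl)
    obtain ⟨k₁, hk₁⟩ := odd_weightSum hD b ((h2 C₁).2 (Or.inl rfl))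
    obtain ⟨k₂, hk₂⟩ := odd_weightSum hD b ((h2 C₂).2 (Or.inr rfl))
    have h3 := weightSum_insert hD b (P := C.pieces) hc fun i => (h1 _).1 ⟨i, rfl⟩
    have h4 := weightSum_union hD b (insert c S) (P := C.pieces) (Q := C₁.pieces)
      (R := C₂.pieces) (fun p => (h1 _).symm.trans ((adjacent_insert_iff p).symm.trans (h2 _)))
      fun p hp hp' => hne (hp.symm.trans hp')
    dsimp only
    omega
  merge S c hc C₁ C₂ C h := by
    obtain ⟨hne, h2, h1⟩ := h
    obtain ⟨k, hk⟩ := odd_weightSum hD b ((h1 C).2 rfl)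
    obtain ⟨k₁, hk₁⟩ := odd_weightSum hD b ((h2 C₁).2 (Or.inl rfl))
    obtain ⟨k₂, hk₂⟩ := odd_weightSum hD b ((h2 C₂).2 (Or.inr rfl))
    have h3 := weightSum_insert hD b (P := C.pieces) hc fun i => (h1 _).1 ⟨i, rfl⟩
    have h4 := weightSum_union hD b S (P := C.pieces) (Q := C₁.pieces)
      (R := C₂.pieces) (fun p => (h1 _).symm.trans ((adjacent_insert_iff p).trans (h2 _))) fun p hp hp' => hne (hp.symm.trans hp')
    dsimp only
    omega
  identify S c _ C C' h := by
    dsimp only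
    rw [← h.2, weightSum_insert_of_notMem hD b fun i hi => h.1 ⟨i, hi⟩]

end Weight

end LinkDiagram

theorem mainTheorem3 (D : LinkDiagram.{u}) (hD : D.SmoothingConnected ∅) :
    ∃ ν : (Σ S : D.State, D.Circle S) → ℤ, D.IsTwistingWeight ν := by
  rcases isEmpty_or_nonempty D.Crossing with hE | ⟨⟨c⟩⟩
  · exact ⟨0, fun _ c => hE.elim c, fun _ c => hE.elim c, fun _ c => hE.elim c⟩
  · have : Nonempty D.Crossing := ⟨c⟩
    exact ⟨_, LinkDiagram.isTwistingWeight_weightSum hD (c, 0)⟩
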